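/- Let $n\ge 0$ be an integer, let $F:\mathbb R^n\times\mathbb R_{\ge 0}\to 2^{\mathbb R^n}$ be a set-valued map, and consider the differential inclusion $\dot x\in F(x,t)$. (This covers the Filippov inclusion of $\dot x=f(x,t)$, where $F(x,t)=\bigcap_{\delta>0}\bigcap_{\mu(S)=0}\overline{\operatorname{co}}\,\{f(\tilde x,t):\|\tilde x-x\|<\delta,\ \tilde x\notin S\}$; its solutions are then called Filippov solutions.) Definitions. An interval is a connected subset of $\mathbb R$ of nonzero Lebesgue measure. A function $g$ is $AC_*$ on a set $S\subseteq\mathbb R$ if for each $\varepsilon>0$ there is $\delta>0$ such that $\sum_{i=1}^m\sup_{a,b\in[a_i,b_i]}\|g(b)-g(a)\|<\varepsilon$ for every finite collection of non-overlapping intervals $[a_i,b_i]$ with $a_i,b_i\in S$ and $\sum_{i=1}^m(b_i-a_i)<\delta$; it is $ACG_*$ on $S$ if $g|_S$ is continuous and $S$ is a countable union of sets on each of which $g$ is $AC_*$. Let $I\subseteq\mathbb R_{\ge 0}$ be an interval. A function $x:I\to\mathbb R^n$ is a classical (respectively generalized) solution if it is absolutely continuous on every compact subinterval of $I$ (respectively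 $ACG_*$ on $I$) and, for almost every $t\in I$, is differentiable at $t$ with $\dot x(t)\in F(x(t),t)$. A classical (generalized) solution $x:I\to\mathbb R^n$ is maximal if there is no classical (generalized) solution $\bar x:\bar I\to\mathbb R^n$ with $\bar I\cap I\ne\emptyset$, $\sup\bar I>\sup I$ and $\bar x=x$ on $I\cap\bar I$. The origin is an attractive equilibrium in the classical (generalized) sense if $0\in F(0,t)$ for almost all $t\ge 0$ and every maximal classical (generalized) solution $x:I\to\mathbb R^n$ satisfies $\lim_{t\to\sup I}x(t)=0$, where $\sup I\in(0,\infty]$. Theorem. Let $D\subseteq\mathbb R_{\ge 0}$ have no cluster points in $\mathbb R$, and suppose that $F$ is locally bounded on $E=\mathbb R^n\times(\mathbb R_{\ge 0}\setminus D)$, i.e. every point of $E$ has a neighborhood $U$ in $E$ such that $\bigcup_{(y,s)\in U}F(y,s)$ is bounded. Suppose that the origin is an attractive equilibrium in the classical sense. Then every maximal generalized solution $x:I\to\mathbb R^n$ satisfies $\sup I=\infty$. If, moreover, $D$ is bounded above, then the origin is an attractive equilibrium in the generalized sense. -/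

import Mathlib

open MeasureTheory Filter Topology Set

/-- A function `g` is absolutely continuous in the restricted sense (`AC*`) on `S ⊆ ℝ`: the
oscillations of `g` over finitely many non-overlapping intervals `[a i, b i]` with endpoints
in `S` and small total length have a small sum. The supremum of `‖g d - g c‖` over
`c, d ∈ [a i, b i]` is the diameter of the image of `[a i, b i]`, taken in `[0, ∞]`; for
`a i ≤ b i`, non-overlapping is the same as disjointness of the half-open intervals. -/
def ACStarOn {n : ℕ} (g : ℝ → EuclideanSpace ℝ (Fin n)) (S : Set ℝ) : Prop :=
  ∀ ε : ℝ, 0 < ε → ∃ δ : ℝ, 0 < δ ∧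
    ∀ (m : ℕ) (a b : Fin m → ℝ),
      (∀ i, a i ≤ b i ∧ a i ∈ S ∧ b i ∈ S) →
      Pairwise (fun i j => Disjoint (Ioc (a i) (b i)) (Ioc (a j) (b j))) →
      ∑ i, (b i - a i) < δ →
      ∑ i, Metric.ediam (g '' Icc (a i) (b i)) < ENNReal.ofReal ε

/-- A function `g` is generalized absolutely continuous in the restricted sense (`ACG*`)
on `S`. -/
def ACGStarOn {n : ℕ} (g : ℝ → EuclideanSpace ℝ (Fin n)) (S : Set ℝ) : Prop :=
  ContinuousOn g S ∧ ∃ C : ℕ → Set ℝ, S = ⋃ k, C k ∧ ∀ k, ACStarOn g (C k)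

/-- Local absolute continuity on `I`: absolute continuity on each compact interval in `I`. -/
def LocallyACOn {n : ℕ} (g : ℝ → EuclideanSpace ℝ (Fin n)) (I : Set ℝ) : Prop :=
  ∀ a b : ℝ, a ≤ b → Icc a b ⊆ I → AbsolutelyContinuousOnInterval g a b

/-- An interval of nonnegative times: a connected subset of `[0, ∞)` of nonzero measure. -/
def IsTimeInterval (I : Set ℝ) : Prop :=
  I ⊆ Ici 0 ∧ IsConnected I ∧ volume I ≠ 0

/-- `x` is differentiable with `x' (t) ∈ F (x t) t` at almost every time `t ∈ I`. -/
def SatisfiesInclusionAE {n : ℕ}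
    (F : EuclideanSpace ℝ (Fin n) → ℝ → Set (EuclideanSpace ℝ (Fin n)))
    (I : Set ℝ) (x : ℝ → EuclideanSpace ℝ (Fin n)) : Prop :=
  ∀ᵐ t : ℝ, t ∈ I → ∃ v ∈ F (x t) t, HasDerivAt x v t

/-- Classical solutions on `I` of the inclusion `x' ∈ F (x, t)`. A function on `I` is represented
by a function on `ℝ` whose values outside `I` play no role; likewise only the values of `F` at
times `t ≥ 0` play a role. -/
def IsClassicalSolution {n : ℕ}
    (F : EuclideanSpace ℝ (Fin n) → ℝ → Set (EuclideanSpace ℝ (Fin n)))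
    (I : Set ℝ) (x : ℝ → EuclideanSpace ℝ (Fin n)) : Prop :=
  IsTimeInterval I ∧ LocallyACOn x I ∧ SatisfiesInclusionAE F I x

/-- Generalized solutions on `I` of the inclusion `x' ∈ F (x, t)`. -/
def IsGeneralizedSolution {n : ℕ}
    (F : EuclideanSpace ℝ (Fin n) → ℝ → Set (EuclideanSpace ℝ (Fin n)))
    (I : Set ℝ) (x : ℝ → EuclideanSpace ℝ (Fin n)) : Prop :=
  IsTimeInterval I ∧ ACGStarOn x I ∧ SatisfiesInclusionAE F I x

/-- The supremum of a set of times, possibly `+∞`. -/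
noncomputable def supTime (I : Set ℝ) : EReal := sSup (Real.toEReal '' I)

/-- Maximality of a solution `x` on `I` among the solutions of the kind `Sol` (classical or
generalized): no solution that agrees with `x` on the nonempty common part of their domains
reaches beyond `sup I`. -/
def IsMaximalSolution {n : ℕ} (Sol : Set ℝ → (ℝ → EuclideanSpace ℝ (Fin n)) → Prop)
    (I : Set ℝ) (x : ℝ → EuclideanSpace ℝ (Fin n)) : Prop :=
  Sol I x ∧ ¬ ∃ (J : Set ℝ) (y : ℝ → EuclideanSpace ℝ (Fin n)),
    Sol J y ∧ (J ∩ I).Nonempty ∧ supTime I < supTime J ∧ ∀ t ∈ I ∩ J, x t = y t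

/-- The origin is an attractive equilibrium of `x' ∈ F (x, t)` with respect to the solutions of
the kind `Sol`: `0 ∈ F (0, t)` for almost all `t ≥ 0`, and every maximal solution `x` on `I`
tends to `0` as `t → sup I` within `I`, where `sup I` may be `+∞`. -/
def IsAttractiveEquilibrium {n : ℕ}
    (F : EuclideanSpace ℝ (Fin n) → ℝ → Set (EuclideanSpace ℝ (Fin n)))
    (Sol : Set ℝ → (ℝ → EuclideanSpace ℝ (Fin n)) → Prop) : Prop :=
  (∀ᵐ t : ℝ, 0 ≤ t → (0 : EuclideanSpace ℝ (Fin n)) ∈ F 0 t) ∧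
  ∀ (I : Set ℝ) (x : ℝ → EuclideanSpace ℝ (Fin n)), IsMaximalSolution Sol I x →
    Tendsto x (comap Real.toEReal (𝓝 (supTime I)) ⊓ 𝓟 I) (𝓝 0)

/-- The origin is an attractive equilibrium in the classical sense. -/
def IsClassicallyAttractive {n : ℕ}
    (F : EuclideanSpace ℝ (Fin n) → ℝ → Set (EuclideanSpace ℝ (Fin n))) : Prop :=
  IsAttractiveEquilibrium F (IsClassicalSolution F)

/-- The origin is an attractive equilibrium in the generalized sense. -/
def IsGeneralizedAttractive {n : ℕ}
    (F : EuclideanSpace ℝ (Fin n) → ℝ → Set (EuclideanSpace ℝ (Fin n))) : Prop :=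
  IsAttractiveEquilibrium F (IsGeneralizedSolution F)

/-- `F` is locally bounded on `ℝⁿ × ([0, ∞) \ D)`: every point of this set has a neighbourhood
in it over which all the values of `F` lie in one ball. -/
def LocallyBoundedOff {n : ℕ}
    (F : EuclideanSpace ℝ (Fin n) → ℝ → Set (EuclideanSpace ℝ (Fin n)))
    (D : Set ℝ) : Prop :=
  ∀ (x : EuclideanSpace ℝ (Fin n)) (t : ℝ), t ∈ Ici 0 \ D →
    ∃ Q : ℝ, ∀ᶠ p : EuclideanSpace ℝ (Fin n) × ℝ in 𝓝[univ ×ˢ (Ici 0 \ D)] (x, t),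
      ∀ v ∈ F p.1 p.2, ‖v‖ ≤ Q

/-! Generalized solutions differ from classical ones only at times in `D`. Along a continuous curve
over a compact interval off `D` the values of `F` are bounded, and an `ACG*` function with bounded
derivative is Lipschitz (`ACGStarOn.norm_sub_le`). This rests on Lusin's condition (N): the
exceptional null set has null image, so the derivative controls monotonicity.

If `sup I = T` were finite, some `[s, T)` would miss `D`, since `D` does not cluster at `T`, and `x`
would be classical there. Either this piece is classically maximal, so `x → 0` at `T` and the zero
solution continues it, or it has a classical continuation. Gluing preserves `ACG*`, even if `T ∈ D`,
which contradicts maximality. If `D` is bounded, a tail of `x` is classical and defined up to `∞`,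
hence maximal, hence tends to `0`. -/

/-! ### Sums of diameters and Lusin's condition (N) -/

/-- The suprema are taken one index at a time; the slack `r` carries the distance at the index held
fixed through the induction. -/
theorem sum_ediam_image_add_le {ι X : Type*} [PseudoEMetricSpace X] (g : ℝ → X)
    (A : ι → Set ℝ) (s : Finset ι) (hA : ∀ i ∈ s, (A i).Nonempty) (C r : ENNReal)
    (h : ∀ p q : ι → ℝ, (∀ i ∈ s, p i ∈ A i ∧ q i ∈ A i) →
      ∑ i ∈ s, edist (g (p i)) (g (q i)) + r ≤ C) :
    ∑ i ∈ s, Metric.ediam (g '' A i) + r ≤ C := by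
  classical
  induction s using Finset.induction_on generalizing r with
  | empty => simpa using h 0 0 (by simp)
  | insert j s hj ih =>
    rcases eq_or_ne C ⊤ with rfl | hC
    · exact le_top
    have key : ∀ c ∈ A j, ∀ d ∈ A j, edist (g c) (g d) +
        (∑ i ∈ s, Metric.ediam (g '' A i) + r) ≤ C := by
      intro c hc d hd
      have := ih (fun i hi => hA i (Finset.mem_insert_of_mem hi)) (edist (g c) (g d) + r) (by
        intro p q hpq
        have := h (Function.update p j c) (Function.update q j d) (by
          intro i hi
          rcases eq_or_ne i j with rfl | hij
          · simp [hc, hd]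
          · simpa [hij] using hpq i (Finset.mem_of_mem_insert_of_ne hi hij))
        rw [Finset.sum_insert hj, Finset.sum_congr rfl (g := fun i => edist (g (p i)) (g (q i)))
          (fun i hi => by
            have : i ≠ j := fun e => hj (e ▸ hi)
            simp [this])] at this
        simp only [Function.update_self] at this
        rwa [add_left_comm, ← add_assoc])
      rwa [add_left_comm] at this
    obtain ⟨c, hc⟩ := hA j (Finset.mem_insert_self _ _)
    have hB : ∑ i ∈ s, Metric.ediam (g '' A i) + r ≤ C := le_add_self.trans (key c hc c hc)
    rw [Finset.sum_insert hj, add_assoc]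
    have : Metric.ediam (g '' A j) ≤ C - (∑ i ∈ s, Metric.ediam (g '' A i) + r) := by
      rw [Metric.ediam_image_le_iff]
      exact fun c hc d hd =>
        ENNReal.le_sub_of_add_le_right (ne_top_of_le_ne_top hC hB) (key c hc d hd)
    calc _ ≤ _ := add_le_add_left this _
      _ = C := tsub_add_cancel_of_le hB

/-- A finite sum of diameters is bounded by any bound for the sums of distances between pairs of
points chosen in the sets. -/
theorem sum_ediam_image_le {ι X : Type*} [PseudoEMetricSpace X] (g : ℝ → X)
    (A : ι → Set ℝ) (s : Finset ι) (hA : ∀ i ∈ s, (A i).Nonempty) (C : ENNReal)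
    (h : ∀ p q : ι → ℝ, (∀ i ∈ s, p i ∈ A i ∧ q i ∈ A i) →
      ∑ i ∈ s, edist (g (p i)) (g (q i)) ≤ C) :
    ∑ i ∈ s, Metric.ediam (g '' A i) ≤ C := by
  simpa using sum_ediam_image_add_le g A s hA C 0 (by simpa using h)

/-- Lusin's condition (N) on a set of absolute continuity. -/
theorem volume_image_inter_eq_zero_of_abs_cont {φ : ℝ → ℝ} {S Z : Set ℝ} (hZ : volume Z = 0)
    (h : ∀ ε : ℝ, 0 < ε → ∃ δ : ℝ, 0 < δ ∧ ∀ (m : ℕ) (a b : Fin m → ℝ),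
      (∀ i, a i ≤ b i ∧ a i ∈ S ∧ b i ∈ S) →
      Pairwise (fun i j => Disjoint (Ioc (a i) (b i)) (Ioc (a j) (b j))) →
      ∑ i, (b i - a i) < δ → ∑ i, |φ (b i) - φ (a i)| ≤ ε) :
    volume (φ '' (S ∩ Z)) = 0 := by
  suffices H : ∀ ε : NNReal, 0 < ε → volume (φ '' (S ∩ Z)) ≤ 0 + ε by
    exact le_antisymm (ENNReal.le_of_forall_pos_le_add fun ε hε _ => H ε hε) bot_le
  intro ε hε
  rw [zero_add]
  obtain ⟨δ, hδ, hS⟩ := h ε (by exact_mod_cast hε)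
  obtain ⟨U, hZU, hU, hUδ⟩ := Z.exists_isOpen_lt_of_lt (μ := volume) (ENNReal.ofReal δ)
    (by rw [hZ]; exact ENNReal.ofReal_pos.2 hδ)
  -- The components of `U` that meet `S ∩ Z` are countably many disjoint intervals of total length
  -- below `δ`. One pair of points of `S` in each of finitely many of them is an admissible family,
  -- and `φ '' (S ∩ c)` has measure at most its diameter.
  set 𝒞 : Set (Set ℝ) := (fun t => connectedComponentIn U t) '' (S ∩ Z) with h𝒞
  have hmem : ∀ t ∈ S ∩ Z, t ∈ connectedComponentIn U t :=
    fun t ht => mem_connectedComponentIn (hZU ht.2)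
  have hopen : ∀ c ∈ 𝒞, IsOpen c := by
    rintro _ ⟨t, -, rfl⟩
    exact hU.connectedComponentIn
  have hsub : ∀ c ∈ 𝒞, c ⊆ U := by
    rintro _ ⟨t, -, rfl⟩
    exact connectedComponentIn_subset _ _
  have hord : ∀ c ∈ 𝒞, OrdConnected c := by
    rintro _ ⟨t, -, rfl⟩
    exact isPreconnected_connectedComponentIn.ordConnected
  have hne : ∀ c ∈ 𝒞, (S ∩ c).Nonempty := by
    rintro _ ⟨t, ht, rfl⟩
    exact ⟨t, ht.1, hmem t ht⟩
  have hdisj : 𝒞.PairwiseDisjoint id := by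
    rintro _ ⟨t, -, rfl⟩ _ ⟨s, -, rfl⟩ hts
    refine Set.disjoint_left.2 fun u hut hus => hts ?_
    exact (connectedComponentIn_eq hut).trans (connectedComponentIn_eq hus).symm
  have hcount : 𝒞.Countable :=
    hdisj.countable_of_isOpen (fun c hc => hopen c hc) fun c hc => (hne c hc).mono inter_subset_right
  have hcover : φ '' (S ∩ Z) ⊆ ⋃ c ∈ 𝒞, φ '' (S ∩ c) := by
    rintro _ ⟨t, ht, rfl⟩
    exact mem_biUnion (mem_image_of_mem _ ht) ⟨t, ⟨ht.1, hmem t ht⟩, rfl⟩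
  refine (measure_mono hcover).trans ((measure_biUnion_le _ hcount _).trans ?_)
  rw [ENNReal.tsum_eq_iSup_sum]
  refine iSup_le fun s => ?_
  refine (Finset.sum_le_sum fun c _ => Real.volume_le_diam _).trans ?_
  refine sum_ediam_image_le φ (fun c : 𝒞 => S ∩ c) s (fun c _ => hne c c.2) ε ?_
  intro p q hpq
  set e := s.equivFin.symm
  have hpq' : ∀ i, p (e i) ∈ S ∩ (e i : 𝒞) ∧ q (e i) ∈ S ∩ (e i : 𝒞) := fun i => hpq _ (e i).2
  have hIcc : ∀ i, uIcc (p (e i)) (q (e i)) ⊆ (e i : 𝒞) := fun i =>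
    (hord _ (e i : 𝒞).2).uIcc_subset (hpq' i).1.2 (hpq' i).2.2
  have hdis : Pairwise fun i j => Disjoint ((e i : 𝒞) : Set ℝ) (e j : 𝒞) := by
    intro i j hij
    refine hdisj (e i : 𝒞).2 (e j : 𝒞).2 fun h => hij (e.injective ?_)
    exact Subtype.ext (Subtype.ext h)
  have hsum := hS s.card (fun i => min (p (e i)) (q (e i))) (fun i => max (p (e i)) (q (e i)))
    (fun i => ⟨min_le_max, by rcases min_choice (p (e i)) (q (e i)) with h | h <;> rw [h] <;>
        simp [(hpq' i).1.1, (hpq' i).2.1],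
      by rcases max_choice (p (e i)) (q (e i)) with h | h <;> rw [h] <;>
        simp [(hpq' i).1.1, (hpq' i).2.1]⟩)
    (fun i j hij => (hdis hij).mono (Ioc_subset_Icc_self.trans (hIcc i))
      (Ioc_subset_Icc_self.trans (hIcc j)))
    (by
      rw [← ENNReal.ofReal_lt_ofReal_iff hδ,
        ENNReal.ofReal_sum_of_nonneg fun i _ => sub_nonneg.2 min_le_max]
      refine lt_of_le_of_lt ?_ hUδ
      calc _ ≤ ∑ i, volume ((e i : 𝒞) : Set ℝ) := by
            refine Finset.sum_le_sum fun i _ => ?_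
            rw [← Real.volume_Icc]
            exact measure_mono (hIcc i)
        _ = volume (⋃ i, ((e i : 𝒞) : Set ℝ)) := by
            rw [measure_iUnion hdis fun i => (hopen _ (e i : 𝒞).2).measurableSet, tsum_fintype]
        _ ≤ volume U := measure_mono (iUnion_subset fun i => hsub _ (e i : 𝒞).2))
  have habs : ∀ i, ENNReal.ofReal |φ (max (p (e i)) (q (e i))) - φ (min (p (e i)) (q (e i)))|
      = edist (φ (p (e i))) (φ (q (e i))) := by
    intro i
    rw [edist_dist, Real.dist_eq]
    rcases le_total (p (e i)) (q (e i)) with h | h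
    · rw [max_eq_right h, min_eq_left h, abs_sub_comm]
    · rw [max_eq_left h, min_eq_right h]
  rw [← Finset.sum_coe_sort s, ← e.sum_comp]
  simp_rw [← habs]
  rw [← ENNReal.ofReal_sum_of_nonneg fun i _ => abs_nonneg _, ← ENNReal.ofReal_coe_nnreal]
  exact ENNReal.ofReal_le_ofReal hsum

variable {n : ℕ}

/-! ### Basic properties of `AC*` -/

theorem ACStarOn.mono {g : ℝ → EuclideanSpace ℝ (Fin n)} {S S' : Set ℝ} (h : ACStarOn g S)
    (hS : S' ⊆ S) : ACStarOn g S' := fun ε hε =>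
  (h ε hε).imp fun _ hδ => ⟨hδ.1, fun m a b hab =>
    hδ.2 m a b fun i => ⟨(hab i).1, hS (hab i).2.1, hS (hab i).2.2⟩⟩

/-- `AC*` sees the values on all of `[a i, b i]`, not only on `S`; hence agreement is needed on an
order-connected set containing `S`. -/
theorem ACStarOn.congr {g h : ℝ → EuclideanSpace ℝ (Fin n)} {S A : Set ℝ} (hg : ACStarOn g S)
    (hSA : S ⊆ A) (hA : A.OrdConnected) (hgh : EqOn g h A) : ACStarOn h S := by
  intro ε hε
  obtain ⟨δ, hδ, H⟩ := hg ε hε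
  refine ⟨δ, hδ, fun m a b hab hd hs => ?_⟩
  have := H m a b hab hd hs
  convert this using 3 with i
  exact image_congr fun t ht => (hgh (hA.out (hSA (hab i).2.1) (hSA (hab i).2.2) ht)).symm

/-- Points chosen in non-overlapping intervals span non-overlapping intervals of no greater length,
so passing to oscillations costs only the strictness of the bound, whence `ε / 2`. -/
theorem AbsolutelyContinuousOnInterval.acStarOn {g : ℝ → EuclideanSpace ℝ (Fin n)} {a b : ℝ}
    (hab : a ≤ b) (h : AbsolutelyContinuousOnInterval g a b) : ACStarOn g (Icc a b) := by
  intro ε hε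
  obtain ⟨δ, hδ, H⟩ := (absolutelyContinuousOnInterval_iff g a b).1 h (ε / 2) (half_pos hε)
  refine ⟨δ, hδ, fun m c d hcd hdis hsum => ?_⟩
  refine lt_of_le_of_lt (b := ENNReal.ofReal (ε / 2)) ?_
    ((ENNReal.ofReal_lt_ofReal_iff hε).2 (half_lt_self hε))
  refine sum_ediam_image_le g (fun i => Icc (c i) (d i)) Finset.univ
    (fun i _ => nonempty_Icc.2 (hcd i).1) _ fun p q hpq => ?_
  have hsub : ∀ i, uIoc (p i) (q i) ⊆ Ioc (c i) (d i) := fun i =>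
    Ioc_subset_Ioc (le_min (hpq i (Finset.mem_univ i)).1.1 (hpq i (Finset.mem_univ i)).2.1)
      (max_le (hpq i (Finset.mem_univ i)).1.2 (hpq i (Finset.mem_univ i)).2.2)
  have hmem : ∀ i, Icc (c i) (d i) ⊆ Icc a b := fun i =>
    Icc_subset_Icc (hcd i).2.1.1 (hcd i).2.2.2
  -- The pairs are indexed by all naturals, but only indices below `m` count; `(0, 0)` is filler.
  have key := H (m, fun i => if hi : i < m then (p ⟨i, hi⟩, q ⟨i, hi⟩) else (0, 0)) ⟨by
      intro i hi
      have hi : i < m := Finset.mem_range.1 hi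
      simp only [hi, dif_pos, uIcc_of_le hab]
      exact ⟨hmem _ (hpq ⟨i, hi⟩ (Finset.mem_univ _)).1, hmem _ (hpq ⟨i, hi⟩ (Finset.mem_univ _)).2⟩,
    by
      intro i hi j hj hij
      have hi : i < m := Finset.mem_range.1 hi
      have hj : j < m := Finset.mem_range.1 hj
      simp only [Function.onFun, hi, hj, dif_pos]
      exact (hdis (i := ⟨i, hi⟩) (j := ⟨j, hj⟩) (by simpa using hij)).mono (hsub _) (hsub _)⟩
    (by
      refine lt_of_le_of_lt ?_ hsum
      rw [Finset.sum_range]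
      refine Finset.sum_le_sum fun i _ => ?_
      simpa using Real.dist_le_of_mem_Icc (hpq i (Finset.mem_univ i)).1 (hpq i (Finset.mem_univ i)).2)
  rw [Finset.sum_range] at key
  simp only [Fin.is_lt, dif_pos] at key
  simp_rw [edist_dist]
  rw [← ENNReal.ofReal_sum_of_nonneg fun i _ => dist_nonneg]
  exact ENNReal.ofReal_le_ofReal key.le

/-! ### Monotonicity and the mean value inequality -/

/-- A continuous function with Lusin's condition (N) whose derivative is negative almost
everywhere does not increase. -/
theorem le_of_deriv_neg_of_volume_image_eq_zero {φ : ℝ → ℝ} {a b : ℝ} {Z : Set ℝ} (hab : a ≤ b)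
    (hφ : ContinuousOn φ (Icc a b)) (hZ : volume (φ '' Z) = 0)
    (hd : ∀ t ∈ Icc a b, t ∉ Z → ∃ r < 0, HasDerivAt φ r t) : φ b ≤ φ a := by
  by_contra! hlt
  -- A null set cannot cover `(φ a, φ b)`. At the last time `c` with `φ c ≤ y` one has `φ c = y`, so
  -- `c ∉ Z`, yet `φ > y` to its right, against a negative derivative.
  obtain ⟨y, hy, hyZ⟩ : ∃ y ∈ Ioo (φ a) (φ b), y ∉ φ '' Z := by
    by_contra! H
    have := measure_mono_null (μ := volume) (show Ioo (φ a) (φ b) ⊆ φ '' Z from H) hZ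
    rw [Real.volume_Ioo, ENNReal.ofReal_eq_zero] at this
    linarith
  have hcpt : IsCompact (Icc a b ∩ φ ⁻¹' Iic y) :=
    isCompact_Icc.of_isClosed_subset (hφ.preimage_isClosed_of_isClosed isClosed_Icc isClosed_Iic)
      inter_subset_left
  obtain ⟨c, ⟨hc, hcy⟩, hmax⟩ := hcpt.exists_isGreatest ⟨a, left_mem_Icc.2 hab, hy.1.le⟩
  have hcb : c < b := lt_of_le_of_ne hc.2 fun e => by
    rw [e] at hcy
    exact absurd hy.2 (not_lt.2 hcy)
  have hgt : ∀ t ∈ Ioc c b, y < φ t := fun t ht => by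
    by_contra! hle
    exact absurd (hmax ⟨⟨hc.1.trans ht.1.le, ht.2⟩, hle⟩) (not_le.2 ht.1)
  obtain ⟨t, ht, hty⟩ := intermediate_value_Icc hc.2 (hφ.mono (Icc_subset_Icc_left hc.1))
    ⟨hcy, hy.2.le⟩
  have htc : t = c := le_antisymm (hmax ⟨⟨hc.1.trans ht.1, ht.2⟩, hty.le⟩) ht.1
  subst htc
  obtain ⟨r, hr, hder⟩ := hd t hc fun hZt => hyZ ⟨t, hZt, hty⟩
  have hslope := (hasDerivWithinAt_iff_tendsto_slope' self_notMem_Ioi).1 hder.hasDerivWithinAt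
    |>.eventually_lt_const hr
  obtain ⟨s, hs, hst⟩ := (hslope.and (Ioc_mem_nhdsGT hcb)).exists
  rw [slope_def_field, div_neg_iff] at hs
  have h1 := hgt s hst
  have h2 := hst.1
  rcases hs with hs | hs <;> linarith [hs.1, hs.2]

/-- The functions `⟪w, x t⟫ - c t` inherit absolute continuity from `x`. -/
theorem ACStarOn.inner_sub_mul {x : ℝ → EuclideanSpace ℝ (Fin n)} {S : Set ℝ} (hx : ACStarOn x S)
    (w : EuclideanSpace ℝ (Fin n)) {c : ℝ} (hc : 0 ≤ c) (ε : ℝ) (hε : 0 < ε) :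
    ∃ δ : ℝ, 0 < δ ∧ ∀ (m : ℕ) (a b : Fin m → ℝ),
      (∀ i, a i ≤ b i ∧ a i ∈ S ∧ b i ∈ S) →
      Pairwise (fun i j => Disjoint (Ioc (a i) (b i)) (Ioc (a j) (b j))) →
      ∑ i, (b i - a i) < δ →
      ∑ i, |(inner ℝ w (x (b i)) - c * b i) - (inner ℝ w (x (a i)) - c * a i)| ≤ ε := by
  obtain ⟨δ, hδ, H⟩ := hx (ε / 2 / (‖w‖ + 1)) (by positivity)
  refine ⟨min δ (ε / 2 / (c + 1)), by positivity, fun m a b hab hd hs => ?_⟩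
  have h1 := H m a b hab hd (hs.trans_le (min_le_left _ _))
  have h2 : ∑ i, ‖x (b i) - x (a i)‖ ≤ ε / 2 / (‖w‖ + 1) := by
    rw [← ENNReal.ofReal_le_ofReal_iff (by positivity),
      ENNReal.ofReal_sum_of_nonneg fun i _ => norm_nonneg _]
    refine le_trans (Finset.sum_le_sum fun i _ => ?_) h1.le
    rw [← dist_eq_norm, ← edist_dist]
    exact Metric.edist_le_ediam_of_mem (mem_image_of_mem _ (right_mem_Icc.2 (hab i).1))
      (mem_image_of_mem _ (left_mem_Icc.2 (hab i).1))
  have h3 : ∑ i, (b i - a i) ≤ ε / 2 / (c + 1) := (hs.trans_le (min_le_right _ _)).le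
  have hpt : ∀ i, |(inner ℝ w (x (b i)) - c * b i) - (inner ℝ w (x (a i)) - c * a i)|
      ≤ (‖w‖ + 1) * ‖x (b i) - x (a i)‖ + (c + 1) * (b i - a i) := by
    intro i
    have e : (inner ℝ w (x (b i)) - c * b i) - (inner ℝ w (x (a i)) - c * a i)
        = inner ℝ w (x (b i) - x (a i)) - c * (b i - a i) := by
      rw [inner_sub_right]; ring
    have hi := abs_real_inner_le_norm w (x (b i) - x (a i))
    have hba := sub_nonneg.2 (hab i).1
    have hn := norm_nonneg (x (b i) - x (a i))
    rw [e]
    refine (abs_sub _ _).trans ?_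
    rw [abs_of_nonneg (mul_nonneg hc hba)]
    nlinarith
  calc _ ≤ ∑ i, ((‖w‖ + 1) * ‖x (b i) - x (a i)‖ + (c + 1) * (b i - a i)) :=
        Finset.sum_le_sum fun i _ => hpt i
    _ = (‖w‖ + 1) * ∑ i, ‖x (b i) - x (a i)‖ + (c + 1) * ∑ i, (b i - a i) := by
        rw [Finset.sum_add_distrib, Finset.mul_sum, Finset.mul_sum]
    _ ≤ (‖w‖ + 1) * (ε / 2 / (‖w‖ + 1)) + (c + 1) * (ε / 2 / (c + 1)) := by gcongr
    _ = ε := by field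

/-- Mean value inequality for `ACG*` functions with bounded derivative. -/
theorem ACGStarOn.norm_sub_le {x : ℝ → EuclideanSpace ℝ (Fin n)} {I : Set ℝ} {a b M : ℝ}
    (hx : ACGStarOn x I) (hM : 0 ≤ M) (hab : a ≤ b) (hI : Icc a b ⊆ I)
    (hd : ∀ᵐ t : ℝ, t ∈ Icc a b → ∃ v, ‖v‖ ≤ M ∧ HasDerivAt x v t) :
    ‖x b - x a‖ ≤ (M + 1) * (b - a) := by
  obtain ⟨hcont, C, rfl, hC⟩ := hx
  set w := x b - x a with hw
  by_contra! hlt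
  have hw0 : 0 < ‖w‖ := lt_of_le_of_lt (mul_nonneg (by linarith) (sub_nonneg.2 hab)) hlt
  set Z := {t | ¬ (t ∈ Icc a b → ∃ v, ‖v‖ ≤ M ∧ HasDerivAt x v t)} with hZdef
  have hZ : volume Z = 0 := ae_iff.1 hd
  -- Its derivative is at most `‖w‖ M - ‖w‖ (M + 1) < 0` off `Z`; the extra `1` makes this strict.
  -- The assumed failure of the bound gives `φ a < φ b`.
  set φ : ℝ → ℝ := fun t => inner ℝ w (x t) - ‖w‖ * (M + 1) * t with hφ
  have hφZ : volume (φ '' Z) = 0 := by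
    have hsub : Z ⊆ ⋃ k, C k ∩ Z := by
      rw [← iUnion_inter]
      exact subset_inter (fun t ht => hI (Classical.not_imp.1 ht).1) Subset.rfl
    refine measure_mono_null (image_mono hsub) ?_
    rw [image_iUnion]
    exact measure_iUnion_null fun k => volume_image_inter_eq_zero_of_abs_cont hZ
      ((hC k).inner_sub_mul w (by positivity))
  have hle := le_of_deriv_neg_of_volume_image_eq_zero (φ := φ) (Z := Z) hab
    (by
      have := hcont.mono hI
      exact (continuousOn_const.inner this).sub (by fun_prop)) hφZ
    (by
      intro t ht htZ
      obtain ⟨v, hv, hder⟩ := (not_not.1 htZ) ht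
      refine ⟨inner ℝ w v - ‖w‖ * (M + 1), ?_, ?_⟩
      · have h1 := real_inner_le_norm w v
        nlinarith
      · have h1 : HasDerivAt (fun s => inner ℝ w (x s)) (inner ℝ w v) t := by
          simpa using (hasDerivAt_const t w).inner ℝ hder
        exact h1.sub (by simpa using (hasDerivAt_id t).const_mul (‖w‖ * (M + 1))))
  have h1 : φ b - φ a = ‖w‖ * (‖w‖ - (M + 1) * (b - a)) := by
    have : inner ℝ w (x b) - inner ℝ w (x a) = ‖w‖ * ‖w‖ := by
      rw [← inner_sub_right, ← hw, real_inner_self_eq_norm_mul_norm]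
    simp only [hφ]
    linear_combination this
  have h2 : 0 < ‖w‖ * (‖w‖ - (M + 1) * (b - a)) := mul_pos hw0 (by linarith)
  linarith

/-! ### Regularity of generalized solutions off `D` -/

/-- Along a continuous curve over a compact set of times off `D`, the values of `F` are bounded. -/
theorem LocallyBoundedOff.exists_bound
    {F : EuclideanSpace ℝ (Fin n) → ℝ → Set (EuclideanSpace ℝ (Fin n))} {D K : Set ℝ}
    (hF : LocallyBoundedOff F D) {x : ℝ → EuclideanSpace ℝ (Fin n)} (hK : IsCompact K)
    (hKD : K ⊆ Ici 0 \ D) (hx : ContinuousOn x K) :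
    ∃ M : ℝ, 0 ≤ M ∧ ∀ t ∈ K, ∀ v ∈ F (x t) t, ‖v‖ ≤ M := by
  refine hK.induction_on (p := fun s => ∃ M : ℝ, 0 ≤ M ∧ ∀ t ∈ s, ∀ v ∈ F (x t) t, ‖v‖ ≤ M)
    ⟨0, le_rfl, by simp⟩ ?_ ?_ ?_
  · rintro s t hst ⟨M, hM, h⟩
    exact ⟨M, hM, fun u hu => h u (hst hu)⟩
  · rintro s t ⟨M, hM, h⟩ ⟨N, hN, h'⟩
    refine ⟨max M N, le_max_of_le_left hM, ?_⟩
    rintro u (hu | hu) v hv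
    · exact (h u hu v hv).trans (le_max_left _ _)
    · exact (h' u hu v hv).trans (le_max_right _ _)
  · intro t ht
    obtain ⟨Q, hQ⟩ := hF (x t) t (hKD ht)
    have htend : Tendsto (fun s => (x s, s)) (𝓝[K] t) (𝓝[univ ×ˢ (Ici 0 \ D)] (x t, t)) := by
      refine tendsto_nhdsWithin_iff.2 ⟨(hx t ht).prodMk_nhds continuousWithinAt_id, ?_⟩
      filter_upwards [self_mem_nhdsWithin] with s hs using ⟨mem_univ _, hKD hs⟩
    exact ⟨_, htend.eventually hQ, max Q 0, le_max_right _ _,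
      fun s hs v hv => (hs v hv).trans (le_max_left _ _)⟩

/-- Off `D`, generalized solutions are locally absolutely continuous. -/
theorem IsGeneralizedSolution.locallyACOn
    {F : EuclideanSpace ℝ (Fin n) → ℝ → Set (EuclideanSpace ℝ (Fin n))} {D I J : Set ℝ}
    (hF : LocallyBoundedOff F D) {x : ℝ → EuclideanSpace ℝ (Fin n)}
    (hx : IsGeneralizedSolution F I x) (hJI : J ⊆ I) (hJD : Disjoint J D) : LocallyACOn x J := by
  obtain ⟨hI, hacg, hinc⟩ := hx
  intro a b hab hJ
  obtain ⟨M, hM, hbound⟩ := hF.exists_bound isCompact_Icc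
    (fun t ht => ⟨hI.1 (hJI (hJ ht)), disjoint_left.1 hJD (hJ ht)⟩)
    (hacg.1.mono (hJ.trans hJI))
  refine LipschitzOnWith.absolutelyContinuousOnInterval (K := ⟨M + 1, by positivity⟩) ?_
  rw [uIcc_of_le hab]
  have key : ∀ c ∈ Icc a b, ∀ d ∈ Icc a b, c ≤ d → ‖x d - x c‖ ≤ (M + 1) * (d - c) := by
    intro c hc d hd hcd
    have hsub : Icc c d ⊆ Icc a b := Icc_subset_Icc hc.1 hd.2
    refine hacg.norm_sub_le hM hcd (hsub.trans (hJ.trans hJI)) ?_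
    filter_upwards [hinc] with t ht htcd
    obtain ⟨v, hv, hder⟩ := ht (hJI (hJ (hsub htcd)))
    exact ⟨v, hbound t (hsub htcd) v hv, hder⟩
  refine LipschitzOnWith.of_dist_le_mul fun c hc d hd => ?_
  rw [dist_eq_norm, Real.dist_eq]
  change _ ≤ (M + 1) * _
  rcases le_total c d with h | h
  · rw [norm_sub_rev, abs_sub_comm, abs_of_nonneg (sub_nonneg.2 h)]
    exact key c hc d hd h
  · rw [abs_of_nonneg (sub_nonneg.2 h)]
    exact key d hd c hc h

variable {F : EuclideanSpace ℝ (Fin n) → ℝ → Set (EuclideanSpace ℝ (Fin n))}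

/-! ### Suprema of time intervals -/

theorem le_supTime {I : Set ℝ} {t : ℝ} (ht : t ∈ I) : (t : EReal) ≤ supTime I :=
  le_sSup (mem_image_of_mem _ ht)

theorem exists_lt_of_lt_supTime {I : Set ℝ} {t : ℝ} (ht : (t : EReal) < supTime I) :
    ∃ s ∈ I, t < s := by
  obtain ⟨_, ⟨s, hs, rfl⟩, hts⟩ := lt_sSup_iff.1 ht
  exact ⟨s, hs, EReal.coe_lt_coe_iff.1 hts⟩

theorem supTime_Ico {s T : ℝ} (h : s < T) : supTime (Ico s T) = T := by
  rw [supTime, EReal.image_coe_Ico]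
  exact (isLUB_Ico (EReal.coe_lt_coe_iff.2 h)).sSup_eq

theorem supTime_Ici (s : ℝ) : supTime (Ici s) = ⊤ := by
  rw [supTime, EReal.image_coe_Ici]
  exact (isLUB_Ico (EReal.coe_lt_top s)).sSup_eq

theorem IsTimeInterval.ordConnected {I : Set ℝ} (hI : IsTimeInterval I) : I.OrdConnected :=
  hI.2.1.isPreconnected.ordConnected

/-- A time interval with finite supremum `T` contains some `[p, T)`. -/
theorem IsTimeInterval.exists_Ico_subset {I : Set ℝ} (hI : IsTimeInterval I) {T : ℝ}
    (hT : supTime I = T) : ∃ p < T, Ico p T ⊆ I := by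
  have hle : ∀ t ∈ I, t ≤ T := fun t ht => EReal.coe_le_coe_iff.1 (hT ▸ le_supTime ht)
  obtain ⟨p, hp, hpT⟩ : ∃ p ∈ I, p < T := by
    by_contra! H
    exact hI.2.2 (measure_mono_null (fun t ht => le_antisymm (hle t ht) (H t ht))
      (measure_singleton T))
  refine ⟨p, hpT, fun t ht => ?_⟩
  obtain ⟨q, hq, htq⟩ := exists_lt_of_lt_supTime (hT ▸ EReal.coe_lt_coe_iff.2 ht.2)
  exact hI.ordConnected.out hp hq ⟨ht.1, htq.le⟩

/-- Off `D`, generalized solutions restrict to classical ones. -/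
theorem IsGeneralizedSolution.isClassicalSolution {D I J : Set ℝ}
    (hF : LocallyBoundedOff F D) {x : ℝ → EuclideanSpace ℝ (Fin n)}
    (hx : IsGeneralizedSolution F I x) (hJ : IsTimeInterval J) (hJI : J ⊆ I)
    (hJD : Disjoint J D) : IsClassicalSolution F J x :=
  ⟨hJ, hx.locallyACOn hF hJI hJD, hx.2.2.mono fun _ ht htJ => ht (hJI htJ)⟩

/-! ### Gluing and continuation -/

/-- `ACG*` on the union of an initial and a final part of an interval. -/
theorem ACGStarOn.piecewise {x y : ℝ → EuclideanSpace ℝ (Fin n)} {I : Set ℝ} {T T' : ℝ}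
    (hI : I.OrdConnected) (hx : ACGStarOn x I) (hT : T < T')
    (hy : AbsolutelyContinuousOnInterval y T T')
    (hlim : Tendsto x (𝓝[I ∩ Iio T] T) (𝓝 (y T))) :
    ACGStarOn (fun t => if t < T then x t else y t) (I ∩ Iio T ∪ Icc T T') := by
  set z := fun t => if t < T then x t else y t with hz
  have hzx : EqOn z x (I ∩ Iio T) := fun t ht => if_pos ht.2
  have hzy : EqOn z y (Icc T T') := fun t ht => if_neg (not_lt.2 ht.1)
  have hzT : z T = y T := hzy (left_mem_Icc.2 hT.le)
  have hycont : ContinuousOn z (Icc T T') := by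
    rw [← uIcc_of_le hT.le] at hzy ⊢
    exact hy.continuousOn.congr hzy
  have hxcont : ContinuousOn z (I ∩ Iio T) := (hx.1.mono inter_subset_left).congr hzx
  refine ⟨?_, ?_⟩
  · have hxT : ContinuousWithinAt z (I ∩ Iio T) T := by
      rw [ContinuousWithinAt, hzT]
      exact hlim.congr' (eventuallyEq_nhdsWithin_of_eqOn hzx.symm)
    intro t ht
    refine ContinuousWithinAt.union ?_ ?_
    · rcases lt_trichotomy t T with h | rfl | h
      · exact hxcont t (ht.resolve_right fun h' => absurd h'.1 (not_le.2 h))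
      · exact hxT
      · refine continuousWithinAt_of_notMem_closure fun hcl => ?_
        have := closure_mono (inter_subset_right : I ∩ Iio T ⊆ Iio T) hcl
        rw [closure_Iio] at this
        exact absurd this (not_le.2 h)
    · by_cases h : t ∈ Icc T T'
      · exact hycont t h
      · exact continuousWithinAt_of_notMem_closure (by rwa [isClosed_Icc.closure_eq])
  · obtain ⟨-, C, hC, hCac⟩ := hx
    -- Index `0` is the new piece; index `k + 1` is the old `C k` cut off below `T`.
    refine ⟨fun k => Nat.casesOn k (Icc T T') fun k => C k ∩ Iio T, ?_, ?_⟩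
    · rw [← Set.union_iUnion_nat_succ, union_comm, hC, iUnion_inter]
      rfl
    · rintro (_ | k)
      · exact (hy.acStarOn hT.le).congr Subset.rfl ordConnected_Icc hzy.symm
      · exact ((hCac k).mono inter_subset_left).congr
          (inter_subset_inter_left _ (hC ▸ subset_iUnion C k)) (hI.inter ordConnected_Iio)
          hzx.symm

/-- A generalized solution that can be continued past the supremum of its domain is not
maximal. -/
theorem IsGeneralizedSolution.not_isMaximalSolution {x y : ℝ → EuclideanSpace ℝ (Fin n)}
    {I : Set ℝ} {T T' : ℝ} (hx : IsGeneralizedSolution F I x) (hsup : supTime I = T)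
    (hT : T < T') (hy : AbsolutelyContinuousOnInterval y T T')
    (hinc : SatisfiesInclusionAE F (Icc T T') y)
    (hlim : Tendsto x (𝓝[I ∩ Iio T] T) (𝓝 (y T))) :
    ¬ IsMaximalSolution (IsGeneralizedSolution F) I x := by
  rintro ⟨-, hmax⟩
  obtain ⟨hI, hacg, hincx⟩ := hx
  obtain ⟨p, hp, hpI⟩ := hI.exists_Ico_subset hsup
  have hpI' : Ico p T ⊆ I ∩ Iio T := fun t ht => ⟨hpI ht, ht.2⟩
  have hp0 : 0 ≤ p := hI.1 (hpI (left_mem_Ico.2 hp))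
  have hord := hI.ordConnected
  refine hmax ⟨I ∩ Iio T ∪ Icc T T', fun t => if t < T then x t else y t,
    ⟨⟨?_, ⟨⟨p, Or.inl (hpI' (left_mem_Ico.2 hp))⟩, OrdConnected.isPreconnected ⟨?_⟩⟩, ?_⟩,
      hacg.piecewise hord hT hy hlim, ?_⟩, ⟨p, ⟨Or.inl (hpI' (left_mem_Ico.2 hp)),
      hpI (left_mem_Ico.2 hp)⟩⟩, ?_, ?_⟩
  · exact union_subset (inter_subset_left.trans hI.1) fun t ht => (hp0.trans hp.le).trans ht.1
  · rintro a ha b hb c ⟨hac, hcb⟩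
    rcases lt_or_ge c T with hc | hc
    · refine Or.inl ⟨?_, hc⟩
      have haI : a ∈ I := (ha.resolve_right fun h => by linarith [h.1]).1
      exact hord.out haI (hpI ⟨le_max_right c p, max_lt hc hp⟩) ⟨hac, le_max_left _ _⟩
    · exact Or.inr ⟨hc, hcb.trans (hb.resolve_left fun h => by linarith [mem_Iio.1 h.2]).2⟩
  · refine (lt_of_lt_of_le ?_ (measure_mono (subset_union_right : Icc T T' ⊆ _))).ne'
    simpa using hT
  -- The glued function may have a corner at `T`, a null set.
  · have hne : ∀ᵐ t : ℝ, t ≠ T := by simp [ae_iff]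
    filter_upwards [hincx, hinc, hne] with t h1 h2 h3 ht
    rcases lt_or_gt_of_ne h3 with h | h
    · obtain ⟨v, hv, hder⟩ := h1 (ht.resolve_right fun h' => by linarith [h'.1]).1
      refine ⟨v, by simpa [h] using hv, hder.congr_of_eventuallyEq ?_⟩
      filter_upwards [Iio_mem_nhds h] with s hs using if_pos hs
    · obtain ⟨v, hv, hder⟩ := h2 (ht.resolve_left fun h' => by linarith [mem_Iio.1 h'.2])
      refine ⟨v, by simpa [h.le.not_gt] using hv, hder.congr_of_eventuallyEq ?_⟩
      filter_upwards [Ioi_mem_nhds h] with s hs using if_neg (not_lt.2 (le_of_lt hs))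
  · rw [hsup]
    exact (EReal.coe_lt_coe_iff.2 hT).trans_le (le_supTime (Or.inr (right_mem_Icc.2 hT.le)))
  · rintro t ⟨htI, -⟩
    have htT : t ≤ T := EReal.coe_le_coe_iff.1 (hsup ▸ le_supTime htI)
    rcases htT.lt_or_eq with h | rfl
    · simp [h]
    -- If `T ∈ I`, continuity of `x` from the left forces `x T = y T`.
    · have : (𝓝[I ∩ Iio t] t).NeBot := by
        rw [← mem_closure_iff_nhdsWithin_neBot]
        refine closure_mono hpI' ?_
        rw [closure_Ico hp.ne]
        exact right_mem_Icc.2 hp.le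
      simpa using tendsto_nhds_unique ((hacg.1 t htI).mono inter_subset_left) hlim

/-! ### Continuation to infinity and attractivity -/

/-- Under classical attractivity, generalized solutions with a finite supremum of their domain can
be continued. -/
theorem IsMaximalSolution.supTime_eq_top {D : Set ℝ}
    (hcluster : ∀ t : ℝ, ¬ AccPt t (𝓟 D)) (hF : LocallyBoundedOff F D)
    (hattr : IsClassicallyAttractive F) {I : Set ℝ} {x : ℝ → EuclideanSpace ℝ (Fin n)}
    (hmax : IsMaximalSolution (IsGeneralizedSolution F) I x) : supTime I = ⊤ := by
  by_contra htop
  have hx := hmax.1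
  have hI := hx.1
  obtain ⟨T, hT⟩ : ∃ T : ℝ, supTime I = T := by
    obtain ⟨t, ht⟩ := hI.2.1.nonempty
    exact ⟨_, (EReal.coe_toReal htop ((EReal.bot_lt_coe t).trans_le (le_supTime ht)).ne').symm⟩
  obtain ⟨p, hp, hpI⟩ := hI.exists_Ico_subset hT
  have hp0 : 0 ≤ p := hI.1 (hpI (left_mem_Ico.2 hp))
  obtain ⟨l, hl, hlD⟩ : ∃ l < T, ∀ t ∈ Ioo l T, t ∉ D := by
    have h := hcluster T
    rw [accPt_iff_frequently, not_frequently] at h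
    have h' : ∀ᶠ t in 𝓝[<] T, t ∉ D := by
      filter_upwards [mem_nhdsWithin_of_mem_nhds h, self_mem_nhdsWithin] with t ht htT htD
      exact ht ⟨ne_of_lt htT, htD⟩
    exact (mem_nhdsLT_iff_exists_Ioo_subset).1 h'
  obtain ⟨s, hs, hsT⟩ := exists_between (max_lt hp hl)
  have hps : p < s := (le_max_left _ _).trans_lt hs
  have hls : l < s := (le_max_right _ _).trans_lt hs
  have hJI : Ico s T ⊆ I := (Ico_subset_Ico_left hps.le).trans hpI
  have hJ : IsTimeInterval (Ico s T) :=
    ⟨fun t ht => hp0.trans (hps.le.trans ht.1), isConnected_Ico hsT, by simpa using hsT⟩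
  have hcl : IsClassicalSolution F (Ico s T) x := hx.isClassicalSolution hF hJ hJI
    (disjoint_left.2 fun t ht => hlD t ⟨hls.trans_le ht.1, ht.2⟩)
  have hmem : ∀ r < T, Ico r T ∈ 𝓝[I ∩ Iio T] T := fun r hr => by
    filter_upwards [self_mem_nhdsWithin, mem_nhdsWithin_of_mem_nhds (Ioi_mem_nhds hr)] with t h1 h2
    exact ⟨le_of_lt h2, h1.2⟩
  by_cases hm : IsMaximalSolution (IsClassicalSolution F) (Ico s T) x
  · have hlim := hattr.2 _ _ hm
    rw [supTime_Ico hsT, ← EReal.isEmbedding_coe.nhds_eq_comap] at hlim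
    -- Since `0 ∈ F 0 t` almost everywhere, resting at the origin continues `x`.
    refine hx.not_isMaximalSolution hT (lt_add_one T) (y := 0)
      (LipschitzOnWith.absolutelyContinuousOnInterval (K := 0)
        ((LipschitzWith.const 0).lipschitzOnWith)) ?_
      (hlim.mono_left (nhdsWithin_le_of_mem (hmem s hsT))) hmax
    filter_upwards [hattr.1] with t ht htT
    exact ⟨0, ht ((hp0.trans hp.le).trans htT.1), hasDerivAt_const t 0⟩
  · obtain ⟨J, y, hy, ⟨r, hrJ, hr⟩, hsup, heq⟩ := not_not.1 fun h => hm ⟨hcl, h⟩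
    rw [supTime_Ico hsT] at hsup
    obtain ⟨T', hT'J, hT'⟩ := exists_lt_of_lt_supTime hsup
    have hsub : Icc r T' ⊆ J := hy.1.ordConnected.out hrJ hT'J
    have hsub' : Icc T T' ⊆ J := (Icc_subset_Icc_left hr.2.le).trans hsub
    refine hx.not_isMaximalSolution hT hT' (y := y) (hy.2.1 T T' hT'.le hsub')
      (hy.2.2.mono fun t ht htT => ht (hsub' htT)) ?_ hmax
    have hcont : ContinuousOn y (Icc r T') := by
      have := (hy.2.1 r T' (hr.2.trans hT').le hsub).continuousOn
      rwa [uIcc_of_le (hr.2.trans hT').le] at this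
    have hyT : Tendsto y (𝓝[Icc r T'] T) (𝓝 (y T)) := hcont T ⟨hr.2.le, hT'.le⟩
    refine (hyT.mono_left (nhdsWithin_le_of_mem (mem_of_superset (hmem r hr.2)
      fun t ht => ⟨ht.1, (ht.2.trans hT').le⟩))).congr' ?_
    filter_upwards [hmem r hr.2] with t ht
    exact (heq t ⟨⟨hr.1.trans ht.1, ht.2⟩, hsub ⟨ht.1, (ht.2.trans hT').le⟩⟩).symm

theorem mainTheorem1 {n : ℕ}
    (F : EuclideanSpace ℝ (Fin n) → ℝ → Set (EuclideanSpace ℝ (Fin n)))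
    (D : Set ℝ) (hD : D ⊆ Set.Ici 0)
    (hcluster : ∀ t : ℝ, ¬ AccPt t (Filter.principal D))
    (hF : LocallyBoundedOff F D)
    (hattr : IsClassicallyAttractive F) :
    (∀ (I : Set ℝ) (x : ℝ → EuclideanSpace ℝ (Fin n)),
      IsMaximalSolution (IsGeneralizedSolution F) I x → supTime I = ⊤) ∧
    (BddAbove D → IsGeneralizedAttractive F) := by
  refine ⟨fun I x hmax => hmax.supTime_eq_top hcluster hF hattr, fun ⟨B, hB⟩ => ⟨hattr.1, ?_⟩⟩
  intro I x hmax
  have htop := hmax.supTime_eq_top hcluster hF hattr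
  have hx := hmax.1
  obtain ⟨s, hsI, hBs⟩ := exists_lt_of_lt_supTime (t := B) (htop ▸ EReal.coe_lt_top B)
  have hsub : Ici s ⊆ I := fun t ht => by
    obtain ⟨q, hq, htq⟩ := exists_lt_of_lt_supTime (t := t) (htop ▸ EReal.coe_lt_top t)
    exact hx.1.ordConnected.out hsI hq ⟨ht, htq.le⟩
  have hcl : IsClassicalSolution F (Ici s) x := hx.isClassicalSolution hF
    ⟨fun t ht => mem_Ici.2 (le_trans (hx.1.1 hsI) ht), isConnected_Ici, by simp⟩ hsub
    (disjoint_left.2 fun t ht htD => absurd (hB htD) (not_le.2 (hBs.trans_le ht)))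
  -- Nothing reaches beyond `⊤`, so the tail is maximal.
  have hlim := hattr.2 _ _ (show IsMaximalSolution (IsClassicalSolution F) (Ici s) x from
    ⟨hcl, fun ⟨J, y, _, _, h, _⟩ => by rw [supTime_Ici] at h; exact not_top_lt h⟩)
  rw [supTime_Ici] at hlim
  rw [htop]
  refine hlim.mono_left (le_inf inf_le_left (le_principal_iff.2 (mem_inf_of_left ?_)))
  exact ⟨Ioi (s : EReal), Ioi_mem_nhds (EReal.coe_lt_top s),
    fun t ht => (EReal.coe_lt_coe_iff.1 ht).le⟩
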